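/- Let $\mathbb{C}\{x\}$ be the absolutely free unitary non-associative $\mathbb{C}$-algebra generated by one element $x$ (its basis consists of $1$ and all bracketed words in $x$), graded by the length of words, and let $d/dx$ be its derivation with $dx/dx=1$. Let $I$ be a homogeneous two-sided ideal of $\mathbb{C}\{x\}$ that is invariant under $d/dx$, and let $R=\mathbb{C}\{x\}/I$, with the induced grading and the induced derivation $r\mapsto r'$. Let $R_0=\{r\in R: r'=0\}$ be the algebra of constants, and let $\mathcal M(R)$ be the algebra of linear operators on $R$ generated by all left and right multiplications, graded by the degree of the multipliers. Let $\widehat R$, $\widehat{R_0}$ and $\widehat{\mathcal M(R)}$ be the completions consisting of the formal infinite sums $\sum_{m\ge 0} r_m$ whose terms $r_m$ are homogeneous of degree $m$ and lie in $R$, $R_0$ and $\mathcal M(R)$, respectively; the derivation extends to $\widehat R$ by $(\sum_m r_m)'=\sum_m r_m'$, and $\widehat{\mathcal M(R)}$ acts on $\widehat R$ in the natural way. Let $\rho$ be the operator of right multiplication by $x$, and for $\lambda\in\mathbb{C}$ let $$\exp(\lambda\rho)=1+\lambda\frac{\rho}{1!}+\lambda^2\frac{\rho^2}{2!}+\lambda^3\frac{\rho^3}{3!}+\cdots\in\widehat{\mathcal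 M(R)}.$$ We write operators on the right of their arguments. **Theorem.** Let $a_1,\ldots,a_n\in\mathbb{C}$, and let $\lambda_1,\ldots,\lambda_p\in\mathbb{C}$ be all the pairwise different roots of $$\lambda^n+a_1\lambda^{n-1}+\cdots+a_{n-1}\lambda+a_n=0,$$ with multiplicities $k_1,\ldots,k_p$, respectively. Then an element $y\in\widehat R$ is a solution of the equation $$y^{(n)}+a_1y^{(n-1)}+\cdots+a_{n-1}y'+a_ny=0$$ if and only if there are constants $c_{ij}\in\widehat{R_0}$ ($1\le i\le p$, $0\le j\le k_i-1$) such that $$y=\sum_{i=1}^{p}\bigl(c_{i0}+c_{i1}\rho+\cdots+c_{i,k_i-1}\rho^{k_i-1}\bigr)\exp(\lambda_i\rho).$$ -/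

import Mathlib

namespace NonassocSeries

noncomputable section

open Finset

/-! ### The free unitary non-associative algebra in one variable -/

/-- The words in one letter `x`, with brackets: the empty word `1` and all non-associative words. -/
abbrev Word : Type := WithOne (FreeMagma Unit)

/-- The length of a word. -/
def Word.deg (w : Word) : ℕ :=
  WithOne.recOneCoe (motive := fun _ => ℕ) 0 (fun u => u.length) w

/-- `K{x}`: the absolutely free unitary non-associative `K`-algebra generated by `x`.
Its basis is the set of words, and words multiply freely. -/
abbrev FreeAlg (K : Type*) [Field K] : Type _ := MonoidAlgebra K Word

variable {K : Type*} [Field K]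

/-- The monomial of a word. -/
def mono (K : Type*) [Field K] (w : Word) : FreeAlg K := MonoidAlgebra.single w 1

/-- The homogeneous polynomials of degree `n` in `K{x}`. -/
def freeHomog (K : Type*) [Field K] (n : ℕ) : Submodule K (FreeAlg K) :=
  MonoidAlgebra.supported K K {w : Word | w.deg = n}

/-- The homogeneous component of degree `n` of a polynomial. -/
def component (n : ℕ) (f : FreeAlg K) : FreeAlg K :=
  MonoidAlgebra.ofCoeff (f.coeff.filter fun w : Word => w.deg = n)

/-- The derivative of a nonempty word: `x' = 1` and `(uv)' = u'v + uv'`. -/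
def magmaDeriv (K : Type*) [Field K] : FreeMagma Unit → FreeAlg K
  | .of _ => 1
  | .mul u v => magmaDeriv K u * mono K (v : Word) + mono K (u : Word) * magmaDeriv K v

/-- The derivative of a word, with `1' = 0`. -/
def wordDeriv (K : Type*) [Field K] (w : Word) : FreeAlg K :=
  WithOne.recOneCoe (motive := fun _ => FreeAlg K) 0 (magmaDeriv K) w

/-- The formal derivative `d/dx` of `K{x}`. -/
def freeDeriv (K : Type*) [Field K] : FreeAlg K →ₗ[K] FreeAlg K :=
  Finsupp.linearCombination K (wordDeriv K) ∘ₗ (MonoidAlgebra.coeffLinearEquiv K).toLinearMap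

/-- An ideal is homogeneous if it contains the homogeneous components of its elements. -/
def IsHomogeneousIdeal (I : TwoSidedIdeal (FreeAlg K)) : Prop :=
  ∀ f ∈ I, ∀ n : ℕ, component n f ∈ I

/-- An ideal is invariant under `d/dx`. -/
def IsDerivInvariant (I : TwoSidedIdeal (FreeAlg K)) : Prop :=
  ∀ f ∈ I, freeDeriv K f ∈ I

theorem mono_mem (w : Word) : mono K w ∈ freeHomog K w.deg := by
  simp only [freeHomog, MonoidAlgebra.mem_supported, mono]
  intro v hv
  have := Finsupp.support_single_subset hv
  simp at this
  simp [this]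

theorem deg_mul (u v : Word) : (u * v).deg = u.deg + v.deg := by
  induction u using WithOne.recOneCoe with
  | one => simp [Word.deg]
  | coe u =>
    induction v using WithOne.recOneCoe with
    | one => simp [Word.deg]
    | coe v => rfl

theorem freeHomog_eq_span (n : ℕ) :
    freeHomog K n = Submodule.span K (mono K '' {w : Word | w.deg = n}) := by
  rw [freeHomog, MonoidAlgebra.supported_eq_span_single]
  rfl

theorem mul_mem_freeHomog {m n : ℕ} {f g : FreeAlg K} (hf : f ∈ freeHomog K m)
    (hg : g ∈ freeHomog K n) : f * g ∈ freeHomog K (m + n) := by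
  rw [freeHomog_eq_span] at hf hg
  induction hf using Submodule.span_induction with
  | zero => simp
  | add a b _ _ ha hb => rw [add_mul]; exact add_mem ha hb
  | smul c a _ ha => rw [smul_mul_assoc]; exact Submodule.smul_mem _ c ha
  | mem f hf =>
    obtain ⟨u, hu, rfl⟩ := hf
    induction hg using Submodule.span_induction with
    | zero => simp
    | add a b _ _ ha hb => rw [mul_add]; exact add_mem ha hb
    | smul c a _ ha => rw [mul_smul_comm]; exact Submodule.smul_mem _ c ha
    | mem g hg =>
      obtain ⟨v, hv, rfl⟩ := hg
      have h := mono_mem (K := K) (u * v)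
      rw [deg_mul, show u.deg = m from hu, show v.deg = n from hv] at h
      simpa [mono] using h

theorem freeDeriv_mono (w : Word) : freeDeriv K (mono K w) = wordDeriv K w := by
  simp [freeDeriv, mono]

theorem magmaDeriv_mem (u : FreeMagma Unit) :
    ∀ n, u.length = n + 1 → magmaDeriv K u ∈ freeHomog K n := by
  induction u with
  | ih1 a =>
    intro n hn
    obtain rfl : n = 0 := by simpa using hn.symm
    exact mono_mem (1 : Word)
  | ih2 u v hu hv =>
    intro n hn
    have hu0 := u.length_pos
    have hv0 := v.length_pos
    obtain ⟨i, hi⟩ : ∃ i, u.length = i + 1 := ⟨u.length - 1, by omega⟩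
    obtain ⟨j, hj⟩ : ∃ j, v.length = j + 1 := ⟨v.length - 1, by omega⟩
    have hn' : u.length + v.length = n + 1 := hn
    refine add_mem ?_ ?_
    · have h := mul_mem_freeHomog (hu i hi) (mono_mem (K := K) (v : Word))
      have e : i + Word.deg (v : Word) = n := by
        change i + v.length = n
        omega
      rwa [e] at h
    · have h := mul_mem_freeHomog (mono_mem (K := K) (u : Word)) (hv j hj)
      have e : Word.deg (u : Word) + j = n := by
        change u.length + j = n
        omega
      rwa [e] at h

theorem freeDeriv_mem {n : ℕ} {f : FreeAlg K} (hf : f ∈ freeHomog K (n + 1)) :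
    freeDeriv K f ∈ freeHomog K n := by
  rw [freeHomog_eq_span] at hf
  induction hf using Submodule.span_induction with
  | zero => simp
  | add a b _ _ ha hb => rw [map_add]; exact add_mem ha hb
  | smul c a _ ha => rw [map_smul]; exact Submodule.smul_mem _ c ha
  | mem f hf =>
    obtain ⟨u, hu, rfl⟩ := hf
    rw [freeDeriv_mono]
    induction u using WithOne.recOneCoe with
    | one => exact absurd hu (by simp [Word.deg])
    | coe u => exact magmaDeriv_mem u n hu

/-! ### The factor algebra `R = K{x}/I`, its derivative, constants and multiplications -/

variable (I : TwoSidedIdeal (FreeAlg K))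

/-- The factor algebra `R = K{x}/I`. -/
abbrev Factor : Type _ := I.ringCon.Quotient

instance : Module K (Factor I) where
  add_smul a b r := by
    obtain ⟨f, rfl⟩ := I.ringCon.mk'_surjective r
    exact congrArg I.ringCon.mk' (add_smul a b f)
  zero_smul r := by
    obtain ⟨f, rfl⟩ := I.ringCon.mk'_surjective r
    exact congrArg I.ringCon.mk' (zero_smul K f)

/-- The projection `K{x} → R`. -/
def proj : FreeAlg K →ₗ[K] Factor I where
  toFun := I.ringCon.mk'
  map_add' := map_add _
  map_smul' _ _ := rfl

/-- The generator `x` of `R`. -/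
def genX : Factor I := proj I (mono K (FreeMagma.of () : FreeMagma Unit))

/-- The homogeneous elements of degree `n` of `R`. -/
def homog (n : ℕ) : Submodule K (Factor I) := (freeHomog K n).map (proj I)

theorem proj_surjective : Function.Surjective (proj I) := I.ringCon.mk'_surjective

theorem proj_mul (f g : FreeAlg K) : proj I (f * g) = proj I f * proj I g := rfl

theorem ker_proj (f : FreeAlg K) : proj I f = 0 ↔ f ∈ I := by
  rw [TwoSidedIdeal.mem_iff]
  exact I.ringCon.eq

theorem mul_mem_homog {m n : ℕ} {r s : Factor I} (hr : r ∈ homog I m) (hs : s ∈ homog I n) :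
    r * s ∈ homog I (m + n) := by
  obtain ⟨f, hf, rfl⟩ := hr
  obtain ⟨g, hg, rfl⟩ := hs
  exact ⟨f * g, mul_mem_freeHomog hf hg, proj_mul I f g⟩

theorem genX_mem : genX I ∈ homog I 1 :=
  ⟨_, mono_mem _, rfl⟩

variable {I}

/-- The derivative of `R` induced by `d/dx`. -/
def deriv (hI : IsDerivInvariant I) : Factor I →ₗ[K] Factor I where
  toFun := Quotient.lift (fun f => proj I (freeDeriv K f)) (by
    intro f g h
    have h' : f - g ∈ I := (I.rel_iff f g).1 h
    have h2 := (ker_proj I _).2 (hI _ h')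
    rwa [map_sub, map_sub, sub_eq_zero] at h2)
  map_add' r s := by
    obtain ⟨f, rfl⟩ := proj_surjective I r
    obtain ⟨g, rfl⟩ := proj_surjective I s
    change proj I (freeDeriv K (f + g)) = _
    rw [map_add, map_add]; rfl
  map_smul' a r := by
    obtain ⟨f, rfl⟩ := proj_surjective I r
    change proj I (freeDeriv K (a • f)) = _
    rw [map_smul, map_smul]; rfl

theorem deriv_proj (hI : IsDerivInvariant I) (f : FreeAlg K) :
    deriv hI (proj I f) = proj I (freeDeriv K f) := rfl

theorem deriv_mem (hI : IsDerivInvariant I) {n : ℕ} {r : Factor I} (hr : r ∈ homog I (n + 1)) :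
    deriv hI r ∈ homog I n := by
  obtain ⟨f, hf, rfl⟩ := hr
  exact ⟨_, freeDeriv_mem hf, rfl⟩

/-- The constants `R₀` of `R`: the kernel of the derivative. -/
def constants (hI : IsDerivInvariant I) : Submodule K (Factor I) := LinearMap.ker (deriv hI)

variable (I)

/-- The algebra of multiplications `M(R)`: the associative algebra of operators on `R` generated
by all left and right multiplications. -/
def multAlg : Subalgebra K (Module.End K (Factor I)) :=
  Algebra.adjoin K (Set.range (fun u : Factor I => LinearMap.mulLeft K u) ∪
    Set.range (fun u : Factor I => LinearMap.mulRight K u))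

/-- The homogeneous component of degree `k` of `M(R)`: the multiplications that raise the degree
by `k`. -/
def multHomog (k : ℕ) : Submodule K (Module.End K (Factor I)) where
  carrier := {m | m ∈ multAlg I ∧ ∀ n, ∀ r ∈ homog I n, m r ∈ homog I (n + k)}
  add_mem' ha hb := ⟨add_mem ha.1 hb.1, fun n r hr => add_mem (ha.2 n r hr) (hb.2 n r hr)⟩
  zero_mem' := ⟨zero_mem _, fun _ _ _ => zero_mem _⟩
  smul_mem' a _ hm := ⟨(multAlg I).smul_mem hm.1 a,
    fun n r hr => Submodule.smul_mem _ a (hm.2 n r hr)⟩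

/-- The operator `ρ` of right multiplication by `x` on `R`. -/
def rho : Module.End K (Factor I) := LinearMap.mulRight K (genX I)

theorem rho_pow_mem (k : ℕ) : rho I ^ k ∈ multHomog I k := by
  have hr : rho I ∈ multAlg I := Algebra.subset_adjoin (Or.inr ⟨genX I, rfl⟩)
  constructor
  · exact pow_mem hr k
  · induction k with
    | zero => intro n r hr; simpa using hr
    | succ k ih =>
      intro n r hr
      rw [pow_succ']
      exact add_assoc n k 1 ▸ mul_mem_homog I (ih n r hr) (genX_mem I)

/-! ### Formal power series -/

/-- The completion `R̂` of `R` in the formal power series topology: the formal infinite sums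
`∑ rₙ` with `rₙ ∈ R` homogeneous of degree `n`, given by the sequence of their components. -/
def Series : Submodule K (ℕ → Factor I) := Submodule.pi Set.univ (homog I)

/-- The completion of the algebra of multiplications `M(R)`: the formal infinite sums `∑ mₖ` with
`mₖ ∈ M(R)` homogeneous of degree `k`. -/
def MultSeries : Submodule K (ℕ → Module.End K (Factor I)) :=
  Submodule.pi Set.univ (multHomog I)

/-- The product of the algebra `R̂`, `(∑ rᵢ)(∑ sⱼ) = ∑ₙ ∑_{i+j=n} rᵢsⱼ`. -/
def seriesMul : Series I →ₗ[K] Series I →ₗ[K] Series I :=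
  LinearMap.mk₂ K
    (fun r s => ⟨fun n => ∑ p ∈ antidiagonal n, r.1 p.1 * s.1 p.2, fun n _ =>
      Submodule.sum_mem _ fun p hp => by
        have := mul_mem_homog I (r.2 p.1 trivial) (s.2 p.2 trivial)
        rwa [mem_antidiagonal.1 hp] at this⟩)
    (fun r s t => Subtype.ext (funext fun n => by simp [add_mul, sum_add_distrib]))
    (fun a r s => Subtype.ext (funext fun n => by simp [smul_sum, smul_mul_assoc]))
    (fun r s t => Subtype.ext (funext fun n => by simp [mul_add, sum_add_distrib]))
    (fun a r s => Subtype.ext (funext fun n => by simp [smul_sum, mul_smul_comm]))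

instance : Mul (Series I) := ⟨fun r s => seriesMul I r s⟩

/-- The element `x` of `R̂`. -/
def seriesX : Series I :=
  ⟨Pi.single 1 (genX I), fun n _ => by
    by_cases h : n = 1
    · subst h; simpa using genX_mem I
    · simp [h]⟩

/-- The operator `ρ : y ↦ yx` of right multiplication by `x` on `R̂`. -/
def seriesRho : Module.End K (Series I) := (seriesMul I).flip (seriesX I)

/-- The action on `R̂` of the completion of `M(R)`: the sum `∑ mₖ` takes `∑ rₗ` to
`∑ₙ ∑_{k+l=n} mₖ(rₗ)`. -/
def act (m : MultSeries I) : Module.End K (Series I) where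
  toFun r := ⟨fun n => ∑ p ∈ antidiagonal n, m.1 p.1 (r.1 p.2), fun n _ =>
    Submodule.sum_mem _ fun p hp => by
      have := (m.2 p.1 trivial).2 p.2 _ (r.2 p.2 trivial)
      rwa [add_comm, mem_antidiagonal.1 hp] at this⟩
  map_add' r s := Subtype.ext (funext fun n => by simp [sum_add_distrib])
  map_smul' a r := Subtype.ext (funext fun n => by simp [smul_sum])

/-- `exp(λρ) = 1 + λρ/1! + λ²ρ²/2! + ⋯`, an element of the completion of `M(R)`. -/
def expRho (l : K) : MultSeries I :=
  ⟨fun k => (l ^ k / (k.factorial : K)) • rho I ^ k,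
    fun k _ => Submodule.smul_mem _ _ (rho_pow_mem I k)⟩

variable {I}

/-- The derivative of `R̂`: the continuous extension `(∑ rₙ)' = ∑ rₙ'` of the derivative of `R`.
The component of degree `n` of the derivative is `(rₙ₊₁)'`, and `(r₀)' = 0`. -/
def seriesDeriv (hI : IsDerivInvariant I) : Module.End K (Series I) where
  toFun r := ⟨fun n => deriv hI (r.1 (n + 1)), fun n _ => deriv_mem hI (r.2 (n + 1) trivial)⟩
  map_add' r s := Subtype.ext (funext fun n => by simp)
  map_smul' a r := Subtype.ext (funext fun n => by simp)

/-- The completion of `R₀` in `R̂`: the formal sums `∑ cₖ` of homogeneous constants `cₖ ∈ R₀`. -/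
def seriesConstants (hI : IsDerivInvariant I) : Submodule K (Series I) where
  carrier := {c | ∀ k, c.1 k ∈ constants hI}
  add_mem' ha hb k := add_mem (ha k) (hb k)
  zero_mem' _ := zero_mem _
  smul_mem' a _ hc k := Submodule.smul_mem _ a (hc k)

end

end NonassocSeries

/-!
The derivation `D` of the completion and the right multiplication `ρ` by `x` satisfy the Weyl
relation `Dρ = ρD + 1`, because `(yx)' = y'x + y`. Over a field of characteristic zero this alone
gives `ker Dᵏ = ∑_{j < k} ρʲ (ker D)` (`weyl_pow_apply_eq_zero_iff`): if `Dᵏ⁺¹ y = 0`, then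
`z = Dᵏ y` is a constant, and `y - ρᵏ z / k!` is annihilated by `Dᵏ`.

The operator `exp(λρ)` is invertible with inverse `exp(-λρ)` (`act_expRho_act_expRho`), and it
intertwines `D - λ` with `D`, that is, `(D - λ) exp(λρ) = exp(λρ) D` (`seriesDeriv_act_expRho`).
Hence it carries `ker Dᵏ` onto `ker (D - λ)ᵏ` (`aeval_X_sub_C_pow_apply_eq_zero_iff`).

The differential equation says that `P(D) y = 0` for the characteristic polynomial
`P = ∏ᵢ (X - λᵢ)^kᵢ`. Its factors are pairwise coprime, so `ker P(D)` is the sum of the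
`ker (D - λᵢ)^kᵢ` (`ker_aeval_prod_of_pairwise_isCoprime`), which are known by the above.
-/

namespace NonassocSeries

open Finset Polynomial

/-! ### Operators satisfying the Weyl relation -/

section Weyl

variable {K V : Type*} [Field K] [AddCommGroup V] [Module K V]

theorem weyl_apply_pow_apply {D ρ : Module.End K V} (h : D * ρ = ρ * D + 1) (j : ℕ) (v : V) :
    D ((ρ ^ (j + 1)) v) = (ρ ^ (j + 1)) (D v) + ((j + 1 : ℕ) : K) • (ρ ^ j) v := by
  have h' (w : V) : D (ρ w) = ρ (D w) + w := congrArg (fun f : Module.End K V => f w) h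
  induction j with
  | zero => simp [h']
  | succ j ih =>
    rw [pow_succ' ρ (j + 1), Module.End.mul_apply, h', ih, map_add, map_smul,
      Module.End.mul_apply, ← Module.End.mul_apply ρ (ρ ^ j), ← pow_succ', add_assoc,
      Nat.cast_succ (j + 1), add_smul, one_smul]

/-- On the kernel of `D`, the operator `Dʲρʲ` is multiplication by `j!`. -/
theorem weyl_pow_pow_apply {D ρ : Module.End K V} (h : D * ρ = ρ * D + 1) {c : V} (hc : D c = 0)
    (j : ℕ) : (D ^ j) ((ρ ^ j) c) = (j.factorial : K) • c := by
  induction j with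
  | zero => simp
  | succ j ih =>
    rw [pow_succ, Module.End.mul_apply, weyl_apply_pow_apply h, hc, map_zero, zero_add, map_smul, ih,
      smul_smul, Nat.factorial_succ, Nat.cast_mul]

/-- The kernel of `Dᵏ` consists of the polynomials in `ρ` of degree less than `k` with coefficients
in the kernel of `D`. -/
theorem weyl_pow_apply_eq_zero_iff [CharZero K] {D ρ : Module.End K V}
    (h : D * ρ = ρ * D + 1) (k : ℕ) (y : V) :
    (D ^ k) y = 0 ↔ ∃ c : Fin k → LinearMap.ker D, y = ∑ j : Fin k, (ρ ^ (j : ℕ)) (c j : V) := by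
  constructor
  · induction k generalizing y with
    | zero => intro hy; exact ⟨Fin.elim0, by simpa using hy⟩
    | succ k ih =>
      intro hy
      have hz : D ((D ^ k) y) = 0 := by rwa [pow_succ', Module.End.mul_apply] at hy
      have hk : (k.factorial : K) ≠ 0 := Nat.cast_ne_zero.2 k.factorial_ne_zero
      -- Since `Dᵏ ρᵏ z = k! z`, the operator `Dᵏ` annihilates `y - ρᵏ z`.
      let z : LinearMap.ker D := (k.factorial : K)⁻¹ • ⟨(D ^ k) y, hz⟩
      obtain ⟨c, hc⟩ := ih (y - (ρ ^ k) z) (by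
        rw [map_sub, weyl_pow_pow_apply h z.2]
        simp [z, smul_smul, hk])
      refine ⟨Fin.snoc c z, ?_⟩
      rw [Fin.sum_univ_castSucc]
      simpa using sub_eq_iff_eq_add.1 hc
  · rintro ⟨c, rfl⟩
    rw [map_sum]
    refine sum_eq_zero fun j _ => ?_
    obtain ⟨i, hi⟩ := Nat.exists_eq_add_of_lt j.2
    have hk : D ^ k = D ^ i * D * D ^ (j : ℕ) := by
      rw [← pow_succ, ← pow_add]
      congr 1
      omega
    rw [hk, Module.End.mul_apply, weyl_pow_pow_apply h (c j).2, map_smul, Module.End.mul_apply,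
      (c j).2, map_zero, smul_zero]

/-- If `E` intertwines `D - λ` with `D`, then it intertwines `(D - λ)ᵏ` with `Dᵏ`. -/
theorem aeval_X_sub_C_pow_apply_apply {D E : Module.End K V} {l : K}
    (h : ∀ v, D (E v) = E (D v) + l • E v) (k : ℕ) (v : V) :
    aeval D ((X - C l) ^ k) (E v) = E ((D ^ k) v) := by
  induction k generalizing v with
  | zero => simp
  | succ k ih =>
    have h1 : aeval D (X - C l) (E v) = E (D v) := by simp [h]
    rw [pow_succ, map_mul, Module.End.mul_apply, h1, ih, pow_succ, Module.End.mul_apply]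

theorem ker_aeval_prod_of_pairwise_isCoprime {ι : Type*} (f : Module.End K V) (s : Finset ι)
    (q : ι → K[X]) (hq : (s : Set ι).Pairwise fun i j => IsCoprime (q i) (q j)) :
    LinearMap.ker (aeval f (∏ i ∈ s, q i)) = ⨆ i ∈ s, LinearMap.ker (aeval f (q i)) := by
  classical
  induction s using Finset.induction_on with
  | empty => simp [LinearMap.ker_eq_bot', Module.End.one_apply]
  | insert i s hi ih =>
    rw [prod_insert hi, ← sup_ker_aeval_eq_ker_aeval_mul_of_coprime, ih, Finset.iSup_insert]
    · exact hq.mono (by simp)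
    · exact IsCoprime.prod_right fun j hj =>
        hq (by simp) (by simp [hj]) (by rintro rfl; exact hi hj)

end Weyl

/-! ### The Leibniz rule -/

variable {K : Type*} [Field K]

theorem wordDeriv_mul (u v : Word) :
    wordDeriv K (u * v) = wordDeriv K u * mono K v + mono K u * wordDeriv K v := by
  induction u using WithOne.recOneCoe with
  | one => simp [wordDeriv, mono, ← MonoidAlgebra.one_def]
  | coe u =>
    induction v using WithOne.recOneCoe with
    | one => simp [wordDeriv, mono, ← MonoidAlgebra.one_def]
    | coe v => rfl

theorem freeDeriv_single (w : Word) (a : K) :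
    freeDeriv K (MonoidAlgebra.single w a) = a • wordDeriv K w := by
  simp [freeDeriv]

theorem freeDeriv_mul (f g : FreeAlg K) :
    freeDeriv K (f * g) = freeDeriv K f * g + f * freeDeriv K g := by
  induction f using MonoidAlgebra.induction_linear with
  | zero => simp
  | add f₁ f₂ h₁ h₂ => simp only [add_mul, map_add, h₁, h₂]; abel
  | single u a =>
    induction g using MonoidAlgebra.induction_linear with
    | zero => simp
    | add g₁ g₂ h₁ h₂ => simp only [mul_add, map_add, h₁, h₂]; abel
    | single v b =>
      have hm (w : Word) (t : K) : MonoidAlgebra.single w t = t • mono K w := by simp [mono]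
      rw [MonoidAlgebra.single_mul_single, freeDeriv_single, freeDeriv_single, freeDeriv_single,
        wordDeriv_mul, hm u a, hm v b]
      simp only [smul_add, smul_mul_assoc, mul_smul_comm, smul_smul, mul_comm b a]

variable {I : TwoSidedIdeal (FreeAlg K)} (hI : IsDerivInvariant I)

theorem deriv_mul (r s : Factor I) : deriv hI (r * s) = deriv hI r * s + r * deriv hI s := by
  obtain ⟨f, rfl⟩ := proj_surjective I r
  obtain ⟨g, rfl⟩ := proj_surjective I s
  rw [← proj_mul, deriv_proj, freeDeriv_mul, map_add]
  rfl

theorem deriv_genX : deriv hI (genX I) = 1 := by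
  rw [genX, deriv_proj, freeDeriv_mono]
  rfl

theorem deriv_eq_zero_of_mem_homog_zero {r : Factor I} (hr : r ∈ homog I 0) : deriv hI r = 0 := by
  obtain ⟨f, hf, rfl⟩ := hr
  have h : freeDeriv K f = 0 := by
    rw [SetLike.mem_coe, freeHomog_eq_span] at hf
    induction hf using Submodule.span_induction with
    | zero => simp
    | add a b _ _ ha hb => rw [map_add, ha, hb, add_zero]
    | smul c a _ ha => rw [map_smul, ha, smul_zero]
    | mem f hf =>
      obtain ⟨u, hu, rfl⟩ := hf
      rw [freeDeriv_mono]
      induction u using WithOne.recOneCoe with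
      | one => rfl
      | coe u => exact absurd hu u.length_pos.ne'
  rw [deriv_proj, h, map_zero]

theorem deriv_mul_rho : deriv hI * rho I = rho I * deriv hI + 1 := by
  ext r
  change deriv hI (r * genX I) = deriv hI r * genX I + r
  rw [deriv_mul, deriv_genX, mul_one]

/-! ### Operators on the completion -/

theorem seriesRho_apply_zero (y : Series I) : (seriesRho I y).1 0 = 0 := by
  change ∑ p ∈ antidiagonal 0, y.1 p.1 * (seriesX I).1 p.2 = 0
  simp [seriesX]

theorem seriesRho_apply_succ (y : Series I) (n : ℕ) :
    (seriesRho I y).1 (n + 1) = rho I (y.1 n) := by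
  change ∑ p ∈ antidiagonal (n + 1), y.1 p.1 * (seriesX I).1 p.2 = y.1 n * genX I
  rw [sum_eq_single (n, 1)]
  · simp [seriesX]
  · rintro ⟨i, j⟩ hij hne
    have hj : j ≠ 1 := by
      rintro rfl
      rw [HasAntidiagonal.mem_antidiagonal] at hij
      exact hne (by simpa using hij)
    simp [seriesX, hj]
  · simp

theorem seriesDeriv_mul_seriesRho :
    seriesDeriv hI * seriesRho I = seriesRho I * seriesDeriv hI + 1 := by
  refine LinearMap.ext fun y => Subtype.ext (funext fun n => ?_)
  change deriv hI ((seriesRho I y).1 (n + 1)) = (seriesRho I (seriesDeriv hI y)).1 n + y.1 n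
  rw [seriesRho_apply_succ, ← Module.End.mul_apply, deriv_mul_rho]
  change rho I (deriv hI (y.1 n)) + y.1 n = _
  congr 1
  cases n with
  | zero =>
    rw [seriesRho_apply_zero, deriv_eq_zero_of_mem_homog_zero hI (y.2 0 trivial), map_zero]
  | succ n => rw [seriesRho_apply_succ]; rfl

/-- The component of degree `0` of a series does not occur in the derivative of the series, but it is
a constant anyway. -/
theorem ker_seriesDeriv : LinearMap.ker (seriesDeriv hI) = seriesConstants hI := by
  ext y
  constructor
  · intro hy n
    cases n with
    | zero => exact deriv_eq_zero_of_mem_homog_zero hI (y.2 0 trivial)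
    | succ n => exact congrFun (congrArg Subtype.val (LinearMap.mem_ker.1 hy)) n
  · intro hy
    exact Subtype.ext (funext fun n => hy (n + 1))

/-! ### The exponential -/

theorem act_expRho_apply (l : K) (y : Series I) (n : ℕ) :
    (act I (expRho I l) y).1 n =
      ∑ p ∈ antidiagonal n, (l ^ p.1 / (p.1.factorial : K)) • (rho I ^ p.1) (y.1 p.2) := rfl

theorem act_expRho_zero : act I (expRho I (0 : K)) = 1 := by
  refine LinearMap.ext fun y => Subtype.ext (funext fun n => ?_)
  rw [act_expRho_apply, sum_eq_single (0, n)]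
  · simp
  · rintro ⟨i, j⟩ hij hne
    have hi : i ≠ 0 := by
      rintro rfl
      rw [HasAntidiagonal.mem_antidiagonal] at hij
      exact hne (by simpa using hij)
    simp [hi]
  · simp

theorem sum_antidiagonal_pow_div_factorial_mul [CharZero K] (l m : K) (n : ℕ) :
    ∑ p ∈ antidiagonal n, l ^ p.1 / (p.1.factorial : K) * (m ^ p.2 / (p.2.factorial : K)) =
      (l + m) ^ n / (n.factorial : K) := by
  rw [(Commute.all l m).add_pow', sum_div]
  refine sum_congr rfl fun p hp => ?_
  rw [← HasAntidiagonal.mem_antidiagonal.1 hp, ← Nat.add_choose_mul_factorial_mul_factorial,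
    ← Nat.choose_symm_add]
  have h1 : (p.1.factorial : K) ≠ 0 := Nat.cast_ne_zero.2 p.1.factorial_ne_zero
  have h2 : (p.2.factorial : K) ≠ 0 := Nat.cast_ne_zero.2 p.2.factorial_ne_zero
  have h3 : ((p.1 + p.2).choose p.1 : K) ≠ 0 :=
    Nat.cast_ne_zero.2 (Nat.choose_pos (Nat.le_add_right _ _)).ne'
  push_cast
  rw [nsmul_eq_mul]
  field_simp

theorem act_expRho_act_expRho [CharZero K] (l m : K) (y : Series I) :
    act I (expRho I l) (act I (expRho I m) y) = act I (expRho I (l + m)) y := by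
  refine Subtype.ext (funext fun n => ?_)
  have hcomp (i j : ℕ) (r : Factor I) : (rho I ^ i) ((rho I ^ j) r) = (rho I ^ (i + j)) r := by
    rw [pow_add, Module.End.mul_apply]
  simp only [act_expRho_apply, ← sum_antidiagonal_pow_div_factorial_mul, map_sum, smul_sum,
    sum_smul, map_smul, smul_smul, hcomp, sum_sigma']
  -- Both sides are sums over triples with sum `n`, bracketed as `i + (k + l)` and `(i + k) + l`.
  refine sum_nbij' (fun ⟨⟨i, _⟩, ⟨k, l⟩⟩ => ⟨(i + k, l), (i, k)⟩)
    (fun ⟨⟨_, j⟩, ⟨k, l⟩⟩ => ⟨(k, l + j), (l, j)⟩) ?_ ?_ ?_ ?_ ?_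
  all_goals
    rintro ⟨⟨i, j⟩, ⟨k, l⟩⟩ h
    simp only [mem_sigma, HasAntidiagonal.mem_antidiagonal] at h
    obtain ⟨rfl, rfl⟩ := h
    simp [add_assoc]

/-- The operators `exp(λρ)` intertwine `D - λ` with `D`. -/
theorem seriesDeriv_act_expRho [CharZero K] (l : K) (y : Series I) :
    seriesDeriv hI (act I (expRho I l) y) =
      act I (expRho I l) (seriesDeriv hI y) + l • act I (expRho I l) y := by
  refine Subtype.ext (funext fun n => ?_)
  change deriv hI ((act I (expRho I l) y).1 (n + 1)) =
    (act I (expRho I l) (seriesDeriv hI y)).1 n + l • (act I (expRho I l) y).1 n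
  -- The index set may be enlarged, because the additional term contains `(y₀)' = 0`.
  have hfirst : (act I (expRho I l) (seriesDeriv hI y)).1 n = ∑ p ∈ antidiagonal (n + 1),
      (l ^ p.1 / (p.1.factorial : K)) • (rho I ^ p.1) (deriv hI (y.1 p.2)) := by
    rw [Nat.sum_antidiagonal_succ', deriv_eq_zero_of_mem_homog_zero hI (y.2 0 trivial), map_zero,
      smul_zero, zero_add]
    rfl
  rw [hfirst, Nat.sum_antidiagonal_succ, act_expRho_apply, act_expRho_apply,
    Nat.sum_antidiagonal_succ, map_add, map_sum, smul_sum, add_assoc, ← sum_add_distrib]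
  congr 1
  · simp
  · refine sum_congr rfl fun p _ => ?_
    have hp : ((p.1 + 1 : ℕ) : K) ≠ 0 := Nat.cast_ne_zero.2 p.1.succ_ne_zero
    have hp' : (p.1.factorial : K) ≠ 0 := Nat.cast_ne_zero.2 p.1.factorial_ne_zero
    rw [map_smul, weyl_apply_pow_apply (deriv_mul_rho hI), smul_add, smul_smul, smul_smul,
      Nat.factorial_succ, Nat.cast_mul]
    congr 2
    field_simp
    rw [pow_succ']

/-- The solutions of `(D - λ)ᵏ y = 0`: the invertible operator `exp(λρ)` reduces them to the case
`λ = 0`. -/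
theorem aeval_X_sub_C_pow_apply_eq_zero_iff [CharZero K] (l : K) (k : ℕ) (y : Series I) :
    aeval (seriesDeriv hI) ((X - C l) ^ k) y = 0 ↔
      ∃ c : Fin k → seriesConstants hI,
        y = act I (expRho I l) (∑ j : Fin k, (seriesRho I ^ (j : ℕ)) (c j : Series I)) := by
  have hinv (m : K) (z : Series I) : act I (expRho I m) (act I (expRho I (-m)) z) = z := by
    rw [act_expRho_act_expRho, add_neg_cancel, act_expRho_zero]; rfl
  have hinj : Function.Injective (act I (expRho I l)) :=
    Function.LeftInverse.injective (g := act I (expRho I (-l)))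
      fun z => by simpa using hinv (-l) z
  have hker (z : Series I) : aeval (seriesDeriv hI) ((X - C l) ^ k) (act I (expRho I l) z) = 0 ↔
      (seriesDeriv hI ^ k) z = 0 := by
    rw [aeval_X_sub_C_pow_apply_apply (seriesDeriv_act_expRho hI l), map_eq_zero_iff _ hinj]
  rw [← ker_seriesDeriv]
  constructor
  · intro hy
    rw [← hinv l y, hker, weyl_pow_apply_eq_zero_iff (seriesDeriv_mul_seriesRho hI)] at hy
    obtain ⟨c, hc⟩ := hy
    exact ⟨c, by rw [← hc, hinv]⟩
  · rintro ⟨c, rfl⟩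
    rw [hker, weyl_pow_apply_eq_zero_iff (seriesDeriv_mul_seriesRho hI)]
    exact ⟨c, rfl⟩

/-! ### The characteristic polynomial -/

theorem monic_X_pow_add_sum {R : Type*} [CommRing R] [Nontrivial R] (n : ℕ) (a : Fin n → R) :
    (X ^ n + ∑ i : Fin n, C (a i) * X ^ (n - 1 - (i : ℕ))).Monic := by
  refine monic_X_pow_add (lt_of_le_of_lt (degree_sum_le _ _) ?_)
  refine (Finset.sup_lt_iff (WithBot.bot_lt_coe n)).2 fun i _ => ?_
  refine lt_of_le_of_lt (degree_C_mul_X_pow_le _ _) ?_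
  exact Nat.cast_lt.2 (by have := i.2; omega)

/-- A monic polynomial over an algebraically closed field is the product of the powers of its linear
factors, for any injective enumeration of its roots. -/
theorem eq_prod_X_sub_C_pow {F ι : Type*} [Field F] [IsAlgClosed F] [Fintype ι] {P : F[X]}
    (hP : P.Monic) {l : ι → F} (hl : Function.Injective l)
    (hroots : ∀ z : F, P.IsRoot z ↔ ∃ i, l i = z) :
    P = ∏ i, (X - C (l i)) ^ P.rootMultiplicity (l i) := by
  classical
  have hs : P.roots.toFinset = univ.image l := by
    ext z
    simpa [hP.ne_zero] using hroots z
  conv_lhs => rw [(IsAlgClosed.splits P).eq_prod_roots_of_monic hP]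
  rw [prod_multiset_map_count, hs, prod_image fun _ _ _ _ h => hl h]
  simp only [count_roots]

end NonassocSeries

open NonassocSeries in
theorem mainTheorem7 (n : ℕ) (a : Fin n → ℂ) (P : Polynomial ℂ)
    (hP : P = Polynomial.X ^ n +
      ∑ i : Fin n, Polynomial.C (a i) * Polynomial.X ^ (n - 1 - (i : ℕ)))
    (p : ℕ) (l : Fin p → ℂ) (hl : Function.Injective l)
    (hroots : ∀ z : ℂ, P.IsRoot z ↔ ∃ i, l i = z)
    (k : Fin p → ℕ) (hk : ∀ i, k i = P.rootMultiplicity (l i))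
    (I : TwoSidedIdeal (FreeAlg ℂ)) (hhom : IsHomogeneousIdeal I) (hI : IsDerivInvariant I)
    (y : Series I) :
    (seriesDeriv hI ^ n) y + ∑ i : Fin n, a i • (seriesDeriv hI ^ (n - 1 - (i : ℕ))) y = 0 ↔
      ∃ c : (i : Fin p) → Fin (k i) → seriesConstants hI,
        y = ∑ i : Fin p, act I (expRho I (l i))
          (∑ j : Fin (k i), (seriesRho I ^ (j : ℕ)) (c i j : Series I)) := by
  have hmonic : P.Monic := hP ▸ monic_X_pow_add_sum n a
  have hfac := eq_prod_X_sub_C_pow hmonic hl hroots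
  simp only [← hk] at hfac
  have heq : (seriesDeriv hI ^ n) y + ∑ i : Fin n, a i • (seriesDeriv hI ^ (n - 1 - (i : ℕ))) y =
      Polynomial.aeval (seriesDeriv hI) P y := by
    simp [hP, LinearMap.sum_apply, ← Polynomial.smul_eq_C_mul]
  have hcop : ((Finset.univ : Finset (Fin p)) : Set (Fin p)).Pairwise fun i j =>
      IsCoprime ((Polynomial.X - Polynomial.C (l i)) ^ k i)
        ((Polynomial.X - Polynomial.C (l j)) ^ k j) := fun i _ j _ hij =>
    (Polynomial.pairwise_coprime_X_sub_C hl hij).pow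
  rw [heq, hfac, ← LinearMap.mem_ker, ker_aeval_prod_of_pairwise_isCoprime _ _ _ hcop,
    Submodule.mem_iSup_finset_iff_exists_sum]
  constructor
  · rintro ⟨μ, rfl⟩
    choose c hc using fun i =>
      (aeval_X_sub_C_pow_apply_eq_zero_iff hI (l i) (k i) _).1 (μ i).2
    exact ⟨c, Finset.sum_congr rfl fun i _ => hc i⟩
  · rintro ⟨c, rfl⟩
    exact ⟨fun i => ⟨_, (aeval_X_sub_C_pow_apply_eq_zero_iff hI (l i) (k i) _).2 ⟨c i, rfl⟩⟩, rfl⟩
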